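/- Let $H$ and $U$ be Hilbert spaces (over $\mathbb{R}$ or $\mathbb{C}$), let $A:\operatorname{dom}(A)\subset H\to H$ generate a $C_0$-semigroup $\{T(t)\}_{t\ge 0}$ on $H$ with $\|T(t)\|\le Me^{\nu t}$ for $t\ge 0$, where $M\ge 1$, $\nu>0$, and let $B\in\mathcal{B}(U,H)$. Let $F\in\mathcal{B}(H,U)$ be a compact operator such that $A+BF$ (with domain $\operatorname{dom}(A)$) generates a $C_0$-semigroup $\{T_{BF}(t)\}_{t\ge 0}$ with $\|T_{BF}(t)\|\le Ne^{-\xi t}$ for $t\ge 0$, where $N\ge 1$, $\xi>0$. Let $f:U\to U$ be such that $f\circ F:H\to U$ is globally Lipschitz continuous and $\|f(Fx)-Fx\|_U\le\theta_f\|x\|_H$ for all $x\in H$, with a constant $\theta_f>0$. Put $\beta:=MN\|B\|_{\mathcal{B}(U,H)}$, suppose that $\theta_f<\xi M\beta^{-1}$ (i.e. $\theta_f\beta<\xi M$, which is no restriction if $B=0$), and let $\zeta\in(\theta_f\beta M^{-1},\xi)$. Let $\mathfrak{D}$ be the set of all locally Lipschitz continuous $d:[0,\infty)\to H$. For $x\in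 H$ and $d\in\mathfrak{D}$ a mild solution of $$\dot x(t)=Ax(t)+Bf(Fx(t))+d(t),\qquad x(0)=x, \qquad (*)$$ is a continuous function $y:[0,\infty)\to H$ with $y(t)=T(t)x+\int_0^tT(t-s)\big(Bf(Fy(s))+d(s)\big)\,\mathrm{d}s$ for all $t\ge 0$. Then $(*)$ has exactly one mild solution, denoted $\phi(\cdot\,;x,d)$, for all $x\in H$ and $d\in\mathfrak{D}$, and the function $$V(x):=\sup_{t\ge 0}\big\|e^{\zeta t}T_{BF}(t)x\big\|_H,\qquad x\in H,$$ is finite, globally Lipschitz continuous, and a coercive ISS Lyapunov function for $(*)$; that is, $V:H\to[0,\infty)$ is continuous and, with $\dot V_d(x):=\limsup_{h\to 0^+}\frac{V(\phi(h;x,d))-V(x)}{h}$ and with $\mathcal{K}_\infty$ the set of continuous, strictly increasing, unbounded functions $a:[0,\infty)\to[0,\infty)$ with $a(0)=0$, 1. there are $\psi_1,\psi_2\in\mathcal{K}_\infty$ such that $\psi_1(\|x\|_H)\le V(x)\le\psi_2(\|x\|_H)$ for all $x\in H$; 2. there are $\alpha,\gamma\in\mathcal{K}_\infty$ such that $\dot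 V_d(x)\le-\alpha(V(x))+\gamma(\|d(0)\|_H)$ for all $x\in H$ and $d\in\mathfrak{D}$. Moreover, for all $x\in H$ and $d\in\mathfrak{D}$, $$\dot V_d(x)\le-\big(\zeta-\theta_f\beta M^{-1}\big)V(x)+N\|d(0)\|_H .$$ -/

import Mathlib

open Filter Topology Set

noncomputable section

/-- A `C₀`-semigroup of bounded operators on `H`. Only the times `t ≥ 0` matter. -/
structure C0Semigroup (𝕜 : Type*) [RCLike 𝕜] (H : Type*) [NormedAddCommGroup H]
    [InnerProductSpace 𝕜 H] where
  /-- The operator at time `t`. -/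
  op : ℝ → H →L[𝕜] H
  op_zero : op 0 = ContinuousLinearMap.id 𝕜 H
  op_add : ∀ s t : ℝ, 0 ≤ s → 0 ≤ t → op (s + t) = (op s).comp (op t)
  tendsto_zero : ∀ x : H, Tendsto (fun t : ℝ => op t x) (𝓝[>] 0) (𝓝 x)

/-- The (unbounded) operator `A` is the infinitesimal generator of `T`: its domain consists of
exactly those `x` for which `lim_{t → 0+} (T(t)x - x)/t` exists, and `A x` is that limit. -/
def C0Semigroup.IsGenerator {𝕜 : Type*} [RCLike 𝕜] {H : Type*} [NormedAddCommGroup H]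
    [InnerProductSpace 𝕜 H] (T : C0Semigroup 𝕜 H) (A : H →ₗ.[𝕜] H) : Prop :=
  ∀ x y : H, (x, y) ∈ A.graph ↔
    Tendsto (fun t : ℝ => ((t : 𝕜)⁻¹) • (T.op t x - x)) (𝓝[>] 0) (𝓝 y)

/-- `y` is a mild solution on `[0, ∞)` of `y' = A y + g(y) + d(t)`, `y(0) = x₀`, where `A` is the
generator of the semigroup `T`. -/
def IsMildSolution {𝕜 : Type*} [RCLike 𝕜] {H : Type*} [NormedAddCommGroup H]
    [InnerProductSpace 𝕜 H] [NormedSpace ℝ H] (T : C0Semigroup 𝕜 H) (g : H → H) (d : ℝ → H)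
    (x₀ : H) (y : ℝ → H) : Prop :=
  ContinuousOn y (Ici 0) ∧
    ∀ t : ℝ, 0 ≤ t → y t = T.op t x₀ + ∫ s in (0 : ℝ)..t, T.op (t - s) (g (y s) + d s)

/-- `d : [0, ∞) → H` is locally Lipschitz (values at negative times are ignored). -/
def IsDisturbance {H : Type*} [NormedAddCommGroup H] (d : ℝ → H) : Prop :=
  LocallyLipschitzOn (Ici 0) d

/-- `φ t x d` is the flow of `y' = A y + g(y) + d(t)`: for every initial state `x` and every
locally Lipschitz `d`, the function `t ↦ φ t x d` is, on `[0, ∞)`, the one and only mild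
solution. -/
def IsMildFlow {𝕜 : Type*} [RCLike 𝕜] {H : Type*} [NormedAddCommGroup H]
    [InnerProductSpace 𝕜 H] [NormedSpace ℝ H] (T : C0Semigroup 𝕜 H) (g : H → H)
    (φ : ℝ → H → (ℝ → H) → H) : Prop :=
  ∀ (x : H) (d : ℝ → H), IsDisturbance d →
    ∀ y : ℝ → H, IsMildSolution T g d x y ↔ EqOn y (fun t => φ t x d) (Ici 0)

/-- Class `𝒦_∞` of functions on `[0, ∞)`. -/
def IsKInfty (a : ℝ → ℝ) : Prop :=
  a 0 = 0 ∧ ContinuousOn a (Ici 0) ∧ StrictMonoOn a (Ici 0) ∧ Tendsto a atTop atTop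

/-- The right upper Dini derivative, as an extended real. -/
def upperRightDini (y : ℝ → ℝ) (t : ℝ) : EReal :=
  limsup (fun h : ℝ => (((y (t + h) - y t) / h : ℝ) : EReal)) (𝓝[>] 0)

/-- The derivative `V̇_d(x)` of `V` along the flow `φ`. -/
def flowDeriv {H : Type*} (φ : ℝ → H → (ℝ → H) → H) (V : H → ℝ) (d : ℝ → H) (x : H) : EReal :=
  upperRightDini (fun t => V (φ t x d)) 0

/-- `V` is a coercive ISS Lyapunov function for the system with flow `φ`. -/
def IsCoerciveISSLyapunov {H : Type*} [NormedAddCommGroup H] (φ : ℝ → H → (ℝ → H) → H)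
    (V : H → ℝ) : Prop :=
  Continuous V ∧ (∀ x, 0 ≤ V x) ∧
  (∃ ψ₁ ψ₂ : ℝ → ℝ, IsKInfty ψ₁ ∧ IsKInfty ψ₂ ∧ ∀ x, ψ₁ ‖x‖ ≤ V x ∧ V x ≤ ψ₂ ‖x‖) ∧
  (∃ α γ : ℝ → ℝ, IsKInfty α ∧ IsKInfty γ ∧ ∀ (x : H) (d : ℝ → H), IsDisturbance d →
    flowDeriv φ V d x ≤ ((-α (V x) + γ ‖d 0‖ : ℝ) : EReal))

/-- The set `{‖e^{ζ t} S(t) x‖ : t ≥ 0}`. -/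
def weightedOrbitNorms {𝕜 : Type*} [RCLike 𝕜] {H : Type*} [NormedAddCommGroup H]
    [InnerProductSpace 𝕜 H] [NormedSpace ℝ H] (S : C0Semigroup 𝕜 H) (ζ : ℝ) (x : H) : Set ℝ :=
  (fun t : ℝ => ‖Real.exp (ζ * t) • S.op t x‖) '' Ici 0

/-- `V(x) = sup_{t ≥ 0} ‖e^{ζ t} S(t) x‖`. -/
def lyapunovV {𝕜 : Type*} [RCLike 𝕜] {H : Type*} [NormedAddCommGroup H]
    [InnerProductSpace 𝕜 H] [NormedSpace ℝ H] (S : C0Semigroup 𝕜 H) (ζ : ℝ) (x : H) : ℝ :=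
  sSup (weightedOrbitNorms S ζ x)

end

/-!
Write `S` for the semigroup generated by `A + BF` and `V(x) = sup_{t ≥ 0} e^{ζt} ‖S(t) x‖`. Since
`S` decays faster than `e^{-ζt}`, the function `V` is finite, subadditive, positively homogeneous
and equivalent to the norm (`norm_le_lyapunovV`, `lyapunovV_le_mul_norm`), hence Lipschitz, and the
weight gives `V(S(h) x) ≤ e^{-ζh} V(x)` (`lyapunovV_ext_le`).

The variation of constants formula `S(h) x = T(h) x + ∫₀ʰ T(h - s) BF S(s) x ds`
(`C0Semigroup.ext_eq_add_integral`) holds for `x` in the domain of the generator by the fundamental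
theorem of calculus, applied to `s ↦ T(h - s) S(s) x` through its right derivative, and for all `x`
by density. Subtracting it from the integral equation of a mild solution `y` leaves
`y(h) = S(h) x + h (B(f(Fx) - Fx) + d(0)) + o(h)` for every `x` in `H`
(`IsMildSolution.tendsto_inv_smul_sub`). Subadditivity of `V` then bounds its Dini derivative by
`-ζ V(x) + V(B(f(Fx) - Fx) + d(0))` (`upperRightDini_lyapunovV_le`), and
`V(r) ≤ N ‖r‖` together with the sector condition and `‖x‖ ≤ V(x)` gives the dissipation
inequality.

Existence and uniqueness of mild solutions is the global solvability of Volterra equations with a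
kernel that is Lipschitz in the state (`exists_global_volterraSolution`,
`IsVolterraSolutionOn.eqOn`): on each bounded interval an iterate of the Picard operator is a
contraction, because the Lipschitz constants of the iterates decay factorially.
-/

/-! ### Nonlinear Volterra equations -/

section Volterra

variable {H : Type*} [NormedAddCommGroup H] [NormedSpace ℝ H]

/-- The Picard operator `u ↦ p + ∫₀ᵗ K t s (u s) ds` of a Volterra equation, acting on continuous
functions on `[0, τ]`; inside the integral `u` is extended to `ℝ` by constants. -/
noncomputable def volterraMap {K : ℝ → ℝ → H → H} {p : ℝ → H}
    (hK : Continuous fun q : ℝ × ℝ × H => K q.1 q.2.1 q.2.2) (hp : Continuous p)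
    {τ : ℝ} (hτ : 0 ≤ τ) (u : C(Icc 0 τ, H)) : C(Icc 0 τ, H) where
  toFun t := p t + ∫ s in (0 : ℝ)..t, K t s (u (projIcc 0 τ hτ s))
  continuous_toFun := by
    have h : Continuous fun t : ℝ => ∫ s in (0 : ℝ)..t, K t s (u (projIcc 0 τ hτ s)) := by
      refine intervalIntegral.continuous_parametric_intervalIntegral_of_continuous ?_
        continuous_id
      exact hK.comp (continuous_fst.prodMk (continuous_snd.prodMk
        (u.continuous.comp (continuous_projIcc.comp continuous_snd))))
    exact (hp.add h).comp continuous_subtype_val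

variable {K : ℝ → ℝ → H → H} {p : ℝ → H}

/-- Factorial decay of the iterates of the Picard operator; it makes some iterate a contraction
on `[0, τ]`, however large `τ` is. -/
lemma norm_volterraMap_iterate_sub_le
    (hK : Continuous fun q : ℝ × ℝ × H => K q.1 q.2.1 q.2.2) (hp : Continuous p)
    {τ : ℝ} (hτ : 0 ≤ τ) {C : ℝ} (hC : 0 ≤ C)
    (hL : ∀ t s, 0 ≤ s → s ≤ t → t ≤ τ → ∀ v w, ‖K t s v - K t s w‖ ≤ C * ‖v - w‖)
    (u v : C(Icc 0 τ, H)) (n : ℕ) (t : Icc 0 τ) :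
    ‖(volterraMap hK hp hτ)^[n] u t - (volterraMap hK hp hτ)^[n] v t‖ ≤
      (C * t) ^ n / n.factorial * dist u v := by
  induction n generalizing t with
  | zero => simpa [dist_eq_norm] using ContinuousMap.dist_apply_le_dist (f := u) (g := v) t
  | succ n ih =>
    obtain ⟨t, ht0, htτ⟩ := t
    simp only [Function.iterate_succ_apply']
    set a := (volterraMap hK hp hτ)^[n] u
    set b := (volterraMap hK hp hτ)^[n] v
    have hcont : ∀ c : C(Icc 0 τ, H),
        Continuous fun s : ℝ => K t s (c (projIcc 0 τ hτ s)) := fun c =>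
      hK.comp (continuous_const.prodMk (continuous_id.prodMk
        (c.continuous.comp continuous_projIcc)))
    have hsub : volterraMap hK hp hτ a ⟨t, ht0, htτ⟩ - volterraMap hK hp hτ b ⟨t, ht0, htτ⟩ =
        ∫ s in (0 : ℝ)..t, (K t s (a (projIcc 0 τ hτ s)) - K t s (b (projIcc 0 τ hτ s))) := by
      rw [intervalIntegral.integral_sub ((hcont a).intervalIntegrable _ _)
        ((hcont b).intervalIntegrable _ _)]
      simp [volterraMap]
    rw [hsub]
    calc _ ≤ ∫ s in (0 : ℝ)..t, C * ((C * s) ^ n / n.factorial * dist u v) := by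
          refine intervalIntegral.norm_integral_le_of_norm_le ht0 ?_
            (Continuous.intervalIntegrable (by fun_prop) _ _)
          refine Eventually.of_forall fun s hs => ?_
          refine (hL t s hs.1.le hs.2 htτ _ _).trans (mul_le_mul_of_nonneg_left ?_ hC)
          rw [projIcc_of_mem hτ ⟨hs.1.le, hs.2.trans htτ⟩]
          exact ih ⟨s, hs.1.le, hs.2.trans htτ⟩
      _ = ∫ s in (0 : ℝ)..t, (C ^ (n + 1) / n.factorial * dist u v) * s ^ n := by
          congr 1; ext s; ring
      _ = (C * t) ^ (n + 1) / (n + 1).factorial * dist u v := by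
          rw [intervalIntegral.integral_const_mul, integral_pow, Nat.factorial_succ]
          push_cast
          field_simp
          ring

lemma exists_contractingWith_volterraMap_iterate
    (hK : Continuous fun q : ℝ × ℝ × H => K q.1 q.2.1 q.2.2) (hp : Continuous p)
    {τ : ℝ} (hτ : 0 ≤ τ)
    (hL : ∃ C, ∀ t s, 0 ≤ s → s ≤ t → t ≤ τ → ∀ v w, ‖K t s v - K t s w‖ ≤ C * ‖v - w‖) :
    ∃ n c, ContractingWith c (volterraMap hK hp hτ)^[n] := by
  obtain ⟨C, hC⟩ := hL
  have hL' : ∀ t s, 0 ≤ s → s ≤ t → t ≤ τ → ∀ v w, ‖K t s v - K t s w‖ ≤ |C| * ‖v - w‖ :=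
    fun t s h1 h2 h3 v w => (hC t s h1 h2 h3 v w).trans
      (mul_le_mul_of_nonneg_right (le_abs_self C) (norm_nonneg _))
  obtain ⟨n, hn⟩ := ((FloorSemiring.tendsto_pow_div_factorial_atTop (|C| * τ)).eventually_lt_const
    one_pos).exists
  have h0 : 0 ≤ (|C| * τ) ^ n / n.factorial := by positivity
  refine ⟨n, ⟨_, h0⟩, by exact_mod_cast hn, LipschitzWith.of_dist_le_mul fun u v => ?_⟩
  rw [ContinuousMap.dist_le (by positivity)]
  intro t
  rw [dist_eq_norm]
  refine (norm_volterraMap_iterate_sub_le hK hp hτ (abs_nonneg C) hL' u v n t).trans ?_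
  refine mul_le_mul_of_nonneg_right ?_ dist_nonneg
  have := t.2.2
  have := t.2.1
  change (|C| * (t : ℝ)) ^ n / n.factorial ≤ (|C| * τ) ^ n / n.factorial
  gcongr

/-- Solutions of the Volterra equation on `[0, τ]`. -/
def IsVolterraSolutionOn (K : ℝ → ℝ → H → H) (p : ℝ → H) (τ : ℝ) (y : ℝ → H) : Prop :=
  ContinuousOn y (Icc 0 τ) ∧ ∀ t ∈ Icc 0 τ, y t = p t + ∫ s in (0 : ℝ)..t, K t s (y s)

lemma IsVolterraSolutionOn.mono {τ τ' : ℝ} {y : ℝ → H} (h : IsVolterraSolutionOn K p τ' y)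
    (hle : τ ≤ τ') : IsVolterraSolutionOn K p τ y :=
  ⟨h.1.mono (Icc_subset_Icc_right hle), fun t ht => h.2 t ⟨ht.1, ht.2.trans hle⟩⟩

lemma IsVolterraSolutionOn.eqOn
    (hK : Continuous fun q : ℝ × ℝ × H => K q.1 q.2.1 q.2.2) (hp : Continuous p)
    {τ : ℝ}
    (hL : ∃ C, ∀ t s, 0 ≤ s → s ≤ t → t ≤ τ → ∀ v w, ‖K t s v - K t s w‖ ≤ C * ‖v - w‖)
    {y z : ℝ → H} (hy : IsVolterraSolutionOn K p τ y) (hz : IsVolterraSolutionOn K p τ z) :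
    EqOn y z (Icc 0 τ) := by
  intro t ht
  have hτ : 0 ≤ τ := ht.1.trans ht.2
  obtain ⟨n, c, hc⟩ := exists_contractingWith_volterraMap_iterate hK hp hτ hL
  have key : ∀ w (hw : IsVolterraSolutionOn K p τ w),
      Function.IsFixedPt (volterraMap hK hp hτ) ⟨(Icc 0 τ).domRestrict w, hw.1.domRestrict⟩ := by
    intro w hw
    ext t
    change p t + ∫ s in (0 : ℝ)..t, K t s (w (projIcc 0 τ hτ s)) = w t
    rw [hw.2 t t.2]
    congr 1
    refine intervalIntegral.integral_congr fun s hs => ?_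
    rw [uIcc_of_le t.2.1] at hs
    simp only [projIcc_of_mem hτ ⟨hs.1, hs.2.trans t.2.2⟩]
  exact congrArg (fun w : C(Icc 0 τ, H) => w ⟨t, ht⟩)
    (hc.fixedPoint_unique' ((key y hy).iterate n) ((key z hz).iterate n))

variable [CompleteSpace H]

lemma exists_isVolterraSolutionOn
    (hK : Continuous fun q : ℝ × ℝ × H => K q.1 q.2.1 q.2.2) (hp : Continuous p)
    {τ : ℝ} (hτ : 0 ≤ τ)
    (hL : ∃ C, ∀ t s, 0 ≤ s → s ≤ t → t ≤ τ → ∀ v w, ‖K t s v - K t s w‖ ≤ C * ‖v - w‖) :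
    ∃ y, IsVolterraSolutionOn K p τ y := by
  obtain ⟨n, c, hc⟩ := exists_contractingWith_volterraMap_iterate hK hp hτ hL
  set u := ContractingWith.fixedPoint _ hc
  have hu : volterraMap hK hp hτ u = u := hc.isFixedPt_fixedPoint_iterate
  refine ⟨fun s => u (projIcc 0 τ hτ s), (u.continuous.comp continuous_projIcc).continuousOn,
    fun t ht => ?_⟩
  have := congrArg (fun w : C(Icc 0 τ, H) => w ⟨t, ht⟩) hu
  simp only [projIcc_of_mem hτ ht]
  exact this.symm

/-- A Volterra equation whose kernel is Lipschitz in the state, uniformly on bounded time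
intervals, is globally solvable: the solutions on the intervals `[0, τ]` are restrictions of one
another. -/
lemma exists_global_volterraSolution
    (hK : Continuous fun q : ℝ × ℝ × H => K q.1 q.2.1 q.2.2) (hp : Continuous p)
    (hL : ∀ τ, ∃ C, ∀ t s, 0 ≤ s → s ≤ t → t ≤ τ → ∀ v w,
      ‖K t s v - K t s w‖ ≤ C * ‖v - w‖) :
    ∃ y, ContinuousOn y (Ici 0) ∧
      ∀ t, 0 ≤ t → y t = p t + ∫ s in (0 : ℝ)..t, K t s (y s) := by
  have hex : ∀ n : ℕ, ∃ y, IsVolterraSolutionOn K p n y := fun n =>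
    exists_isVolterraSolutionOn hK hp n.cast_nonneg (hL n)
  choose Y hY using hex
  have heq : ∀ (n : ℕ), EqOn (fun t => Y ⌈t⌉₊ t) (Y n) (Icc 0 n) := by
    intro n t ht
    have hle : ((⌈t⌉₊ : ℕ) : ℝ) ≤ n := by exact_mod_cast Nat.ceil_le.2 ht.2
    exact (hY ⌈t⌉₊).eqOn hK hp (hL _) ((hY n).mono hle) ⟨ht.1, Nat.le_ceil t⟩
  refine ⟨fun t => Y ⌈t⌉₊ t, fun t ht => ?_, fun t ht => ?_⟩
  · obtain ⟨n, hn⟩ := exists_nat_gt t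
    have h1 : ContinuousWithinAt (fun t => Y ⌈t⌉₊ t) (Icc 0 n) t :=
      (((hY n).1).congr (heq n)) t ⟨ht, hn.le⟩
    refine h1.mono_of_mem_nhdsWithin ?_
    filter_upwards [self_mem_nhdsWithin, mem_nhdsWithin_of_mem_nhds (Iio_mem_nhds hn)] with s h0 h1
    exact ⟨h0, h1.le⟩
  · change Y ⌈t⌉₊ t = _
    rw [(hY ⌈t⌉₊).2 t ⟨ht, Nat.le_ceil t⟩]
    congr 1
    refine intervalIntegral.integral_congr fun s hs => ?_
    rw [uIcc_of_le ht] at hs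
    simp only [← heq ⌈t⌉₊ ⟨hs.1, hs.2.trans (Nat.le_ceil t)⟩]

end Volterra

/-! ### Strong continuity -/

section Semigroup

variable {𝕜 : Type*} [RCLike 𝕜] {H : Type*} [NormedAddCommGroup H] [InnerProductSpace 𝕜 H]

namespace C0Semigroup

/-- The semigroup extended to negative times by the identity, which makes it strongly continuous
on all of `ℝ`. -/
def ext (T : C0Semigroup 𝕜 H) (t : ℝ) : H →L[𝕜] H := T.op (max t 0)

lemma ext_of_nonneg (T : C0Semigroup 𝕜 H) {t : ℝ} (ht : 0 ≤ t) : T.ext t = T.op t := by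
  rw [ext, max_eq_left ht]

@[simp] lemma ext_zero_apply (T : C0Semigroup 𝕜 H) (x : H) : T.ext 0 x = x := by
  simp [ext, T.op_zero]

lemma ext_add_apply (T : C0Semigroup 𝕜 H) {s t : ℝ} (hs : 0 ≤ s) (ht : 0 ≤ t) (x : H) :
    T.ext (s + t) x = T.ext s (T.ext t x) := by
  rw [T.ext_of_nonneg hs, T.ext_of_nonneg ht, T.ext_of_nonneg (add_nonneg hs ht),
    T.op_add s t hs ht]
  rfl

/-- `T` is bounded in operator norm on every bounded interval `[0, τ]`; negative times add only the
identity, the value of the extension there. -/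
def IsLocallyBounded (T : C0Semigroup 𝕜 H) : Prop :=
  ∀ τ : ℝ, ∃ C : ℝ, ∀ t ≤ τ, ‖T.ext t‖ ≤ C

lemma isLocallyBounded_of_le_exp {T : C0Semigroup 𝕜 H} {M ω : ℝ}
    (hT : ∀ t : ℝ, 0 ≤ t → ‖T.op t‖ ≤ M * Real.exp (ω * t)) : T.IsLocallyBounded := by
  intro τ
  have hM : 0 ≤ M := by simpa using (norm_nonneg _).trans (hT 0 le_rfl)
  refine ⟨M * Real.exp (|ω| * max τ 0), fun t ht => (hT _ (le_max_right _ _)).trans ?_⟩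
  have h1 : ω * max t 0 ≤ |ω| * max τ 0 :=
    mul_le_mul (le_abs_self ω) (max_le_max_right 0 ht) (le_max_right _ _) (abs_nonneg ω)
  gcongr

lemma tendsto_ext_abs (T : C0Semigroup 𝕜 H) (x : H) :
    Tendsto (fun h : ℝ => T.ext |h| x) (𝓝 0) (𝓝 x) := by
  have h1 : Tendsto (fun h : ℝ => T.ext h x) (𝓝[≥] 0) (𝓝 x) := by
    rw [← Ioi_insert, nhdsWithin_insert, tendsto_sup]
    constructor
    · simpa using tendsto_pure_nhds (fun h : ℝ => T.ext h x) 0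
    · refine (T.tendsto_zero x).congr' ?_
      filter_upwards [self_mem_nhdsWithin] with h hh
      rw [T.ext_of_nonneg (le_of_lt hh)]
  refine h1.comp (tendsto_nhdsWithin_iff.2 ⟨?_, Eventually.of_forall fun h => abs_nonneg h⟩)
  simpa using (continuous_abs (G := ℝ)).tendsto 0

lemma IsLocallyBounded.continuous_ext_apply {T : C0Semigroup 𝕜 H} (hT : T.IsLocallyBounded) :
    Continuous fun q : ℝ × H => T.ext q.1 q.2 := by
  rw [continuous_iff_continuousAt]
  rintro ⟨t, x⟩
  obtain ⟨C, hC⟩ := hT (t + 1)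
  have hbound : ∀ᶠ q : ℝ × H in 𝓝 (t, x),
      ‖T.ext q.1 q.2 - T.ext t x‖ ≤
        C * ‖q.2 - x‖ + C * ‖T.ext |max q.1 0 - max t 0| x - x‖ := by
    have hlt : ∀ᶠ q : ℝ × H in 𝓝 (t, x), q.1 < t + 1 :=
      continuous_fst.continuousAt.eventually_lt_const (by simp)
    filter_upwards [hlt] with ⟨s, v⟩ hs
    have key : ∀ a b : ℝ, a ≤ b → a ≤ t + 1 →
        ‖T.ext b x - T.ext a x‖ ≤ C * ‖T.ext |max b 0 - max a 0| x - x‖ := by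
      intro a b hab ha
      have hd : 0 ≤ max b 0 - max a 0 := sub_nonneg.2 (max_le_max_right 0 hab)
      have hadd := T.ext_add_apply (le_max_right a 0) hd x
      have hb : T.ext b x = T.ext (max a 0) (T.ext (max b 0 - max a 0) x) := by
        rw [← hadd, add_sub_cancel]; simp [ext]
      have ha' : T.ext (max a 0) = T.ext a := by simp [ext]
      rw [abs_of_nonneg hd, hb, ha', ← map_sub]
      exact (T.ext a).le_of_opNorm_le (hC a ha) _
    have h2 : ‖T.ext s x - T.ext t x‖ ≤ C * ‖T.ext |max s 0 - max t 0| x - x‖ := by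
      rcases le_total t s with h | h
      · exact key t s h (by linarith)
      · rw [norm_sub_rev, abs_sub_comm]
        exact key s t h hs.le
    calc ‖T.ext s v - T.ext t x‖ = ‖T.ext s (v - x) + (T.ext s x - T.ext t x)‖ := by
          rw [map_sub]; congr 1; abel
      _ ≤ ‖T.ext s (v - x)‖ + ‖T.ext s x - T.ext t x‖ := norm_add_le _ _
      _ ≤ _ := add_le_add ((T.ext s).le_of_opNorm_le (hC s hs.le) _) h2
  rw [ContinuousAt, tendsto_iff_norm_sub_tendsto_zero]
  refine squeeze_zero' (Eventually.of_forall fun _ => norm_nonneg _) hbound ?_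
  have h1 : Tendsto (fun q : ℝ × H => C * ‖q.2 - x‖) (𝓝 (t, x)) (𝓝 0) := by
    have : Continuous fun q : ℝ × H => C * ‖q.2 - x‖ := by fun_prop
    simpa using this.tendsto (t, x)
  have h2 : Tendsto (fun q : ℝ × H => max q.1 0 - max t 0) (𝓝 (t, x)) (𝓝 0) := by
    have : Continuous fun q : ℝ × H => max q.1 0 - max t 0 := by fun_prop
    simpa using this.tendsto (t, x)
  have h3 := (((T.tendsto_ext_abs x).comp h2).sub_const x).norm.const_mul C
  simpa using h1.add h3

lemma IsLocallyBounded.continuous_ext_comp {T : C0Semigroup 𝕜 H} (hT : T.IsLocallyBounded)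
    {X : Type*} [TopologicalSpace X] {a : X → ℝ} {v : X → H} (ha : Continuous a)
    (hv : Continuous v) : Continuous fun q => T.ext (a q) (v q) :=
  hT.continuous_ext_apply.comp (ha.prodMk hv)

/-! ### Convolutions -/

variable [NormedSpace ℝ H]

lemma IsLocallyBounded.continuous_convolution {T : C0Semigroup 𝕜 H} (hT : T.IsLocallyBounded)
    {w : ℝ → H} (hw : Continuous w) :
    Continuous fun t : ℝ => ∫ s in (0 : ℝ)..t, T.ext (t - s) (w s) :=
  intervalIntegral.continuous_parametric_intervalIntegral_of_continuous
    (hT.continuous_ext_comp (continuous_fst.sub continuous_snd) (hw.comp continuous_snd))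
    continuous_id

/-- The rescaling `s = h r` turns the mean of the convolution into an integral over `[0, 1]` that
depends continuously on `h`. -/
lemma IsLocallyBounded.tendsto_inv_smul_convolution {T : C0Semigroup 𝕜 H}
    (hT : T.IsLocallyBounded) [CompleteSpace H] {w : ℝ → H} (hw : Continuous w) :
    Tendsto (fun h : ℝ => h⁻¹ • ∫ s in (0 : ℝ)..h, T.ext (h - s) (w s)) (𝓝[>] 0) (𝓝 (w 0)) := by
  have hc : Continuous fun h : ℝ => ∫ r in (0 : ℝ)..1, T.ext (h - h * r) (w (h * r)) :=
    intervalIntegral.continuous_parametric_intervalIntegral_of_continuous'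
      (hT.continuous_ext_comp (by fun_prop) (hw.comp (by fun_prop))) _ _
  have h0 := (hc.tendsto 0).mono_left (nhdsWithin_le_nhds (s := Ioi 0))
  simp only [zero_mul, sub_zero, ext_zero_apply, intervalIntegral.integral_const, one_smul] at h0
  refine h0.congr' ?_
  filter_upwards [self_mem_nhdsWithin] with h hh
  have := intervalIntegral.integral_comp_mul_left (a := 0) (b := 1)
    (fun s => T.ext (h - s) (w s)) (ne_of_gt hh)
  simpa using this

end C0Semigroup

end Semigroup

/-! ### Generators and the variation of constants formula -/

section Generator

variable {𝕜 : Type*} [RCLike 𝕜] {H : Type*} [NormedAddCommGroup H] [InnerProductSpace 𝕜 H]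
  [NormedSpace ℝ H]

namespace C0Semigroup

/-- The orbit `t ↦ T(t) x` has right derivative `y` at `0`; that is, `x` lies in the domain of the
generator of `T`, which maps `x` to `y`. -/
def HasGen (T : C0Semigroup 𝕜 H) (x y : H) : Prop :=
  Tendsto (fun k : ℝ => k⁻¹ • (T.ext k x - x)) (𝓝[>] 0) (𝓝 y)

lemma IsGenerator.mem_graph_iff [IsScalarTower ℝ 𝕜 H] {T : C0Semigroup 𝕜 H} {A : H →ₗ.[𝕜] H}
    (hA : T.IsGenerator A) (x y : H) : (x, y) ∈ A.graph ↔ T.HasGen x y := by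
  rw [hA x y, HasGen]
  refine tendsto_congr' ?_
  filter_upwards [self_mem_nhdsWithin] with k hk
  rw [T.ext_of_nonneg (le_of_lt hk), RCLike.real_smul_eq_coe_smul (K := 𝕜), RCLike.ofReal_inv]

/-- The domain of the generator is invariant under the semigroup. -/
lemma HasGen.ext_apply [IsScalarTower ℝ 𝕜 H] {T : C0Semigroup 𝕜 H} {x y : H} (h : T.HasGen x y)
    {t : ℝ} (ht : 0 ≤ t) : T.HasGen (T.ext t x) (T.ext t y) := by
  refine (((T.ext t).continuous.tendsto y).comp h).congr' ?_
  filter_upwards [self_mem_nhdsWithin] with k hk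
  have hk' : 0 ≤ k := le_of_lt hk
  rw [Function.comp_apply, ← T.ext_add_apply hk' ht, add_comm k t, T.ext_add_apply ht hk',
    ← map_sub, RCLike.real_smul_eq_coe_smul (K := 𝕜), RCLike.real_smul_eq_coe_smul (K := 𝕜),
    map_smul]

lemma HasGen.real_smul [IsScalarTower ℝ 𝕜 H] {T : C0Semigroup 𝕜 H} {x y : H} (h : T.HasGen x y)
    (c : ℝ) : T.HasGen (c • x) (c • y) := by
  refine (h.const_smul c).congr fun k => ?_
  rw [RCLike.real_smul_eq_coe_smul (K := 𝕜) c x, map_smul, ← RCLike.real_smul_eq_coe_smul,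
    ← RCLike.real_smul_eq_coe_smul, ← smul_sub, smul_comm]

/-- Integrals of orbits lie in the domain of the generator. -/
lemma IsLocallyBounded.hasGen_integral [CompleteSpace H] {T : C0Semigroup 𝕜 H}
    (hT : T.IsLocallyBounded) {h : ℝ} (hh : 0 ≤ h) (x : H) :
    T.HasGen (∫ s in (0 : ℝ)..h, T.ext s x) (T.ext h x - x) := by
  have hc : Continuous fun s : ℝ => T.ext s x :=
    hT.continuous_ext_comp continuous_id continuous_const
  set G : ℝ → H := fun t => ∫ s in (0 : ℝ)..t, T.ext s x with hG
  have hslope : ∀ t, Tendsto (fun k : ℝ => k⁻¹ • (G (t + k) - G t)) (𝓝[>] 0) (𝓝 (T.ext t x)) :=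
    fun t => (hasDerivAt_iff_tendsto_slope_zero.1
      (hc.integral_hasStrictDerivAt 0 t).hasDerivAt).mono_left
        (nhdsWithin_mono _ fun k hk => ne_of_gt hk)
  have hlim := (hslope h).sub (hslope 0)
  rw [ext_zero_apply] at hlim
  refine hlim.congr' ?_
  filter_upwards [self_mem_nhdsWithin] with k hk
  have hk' : 0 ≤ k := le_of_lt hk
  have h1 : T.ext k (G h) = G (h + k) - G k := by
    have e1 : T.ext k (G h) = ∫ s in (0 : ℝ)..h, T.ext k (T.ext s x) :=
      (((T.ext k).intervalIntegral_comp_comm (hc.intervalIntegrable _ _))).symm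
    have e2 : ∫ s in (0 : ℝ)..h, T.ext k (T.ext s x) = ∫ s in (0 : ℝ)..h, T.ext (s + k) x := by
      refine intervalIntegral.integral_congr fun s hs => ?_
      rw [uIcc_of_le hh] at hs
      rw [← T.ext_add_apply hk' hs.1, add_comm]
    rw [e1, e2, intervalIntegral.integral_comp_add_right (fun s => T.ext s x), zero_add]
    exact (intervalIntegral.integral_interval_sub_left (hc.intervalIntegrable _ _)
      (hc.intervalIntegrable _ _)).symm
  have h2 : G 0 = 0 := intervalIntegral.integral_same
  change k⁻¹ • (G (h + k) - G h) - k⁻¹ • (G (0 + k) - G 0) = k⁻¹ • (T.ext k (G h) - G h)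
  rw [h1, h2, ← smul_sub, zero_add]
  congr 1
  abel

variable [IsScalarTower ℝ 𝕜 H]

/-- The right derivative of `s ↦ T(h - s) S(s) x`, when the generators of `S` and `T` differ by
`P`. -/
lemma hasDerivWithinAt_ext_sub_ext {T S : C0Semigroup 𝕜 H} (hT : T.IsLocallyBounded)
    {P : H →L[𝕜] H} (hTS : ∀ x y, S.HasGen x y → T.HasGen x (y - P x))
    {x y : H} (hx : S.HasGen x y) {h s : ℝ} (hs : 0 ≤ s) (hsh : s < h) :
    HasDerivWithinAt (fun s => T.ext (h - s) (S.ext s x)) (T.ext (h - s) (P (S.ext s x)))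
      (Ioi s) s := by
  rw [hasDerivWithinAt_iff_tendsto_slope' self_notMem_Ioi]
  set z := S.ext s x with hz
  have hzS : S.HasGen z (S.ext s y) := hx.ext_apply hs
  have hdiff : Tendsto (fun k : ℝ => k⁻¹ • (S.ext k z - T.ext k z)) (𝓝[>] 0) (𝓝 (P z)) := by
    have := Tendsto.sub hzS (hTS _ _ hzS)
    rw [sub_sub_cancel] at this
    refine this.congr fun k => ?_
    rw [← smul_sub, sub_sub_sub_cancel_right]
  have hshift : Tendsto (fun r : ℝ => r - s) (𝓝[>] s) (𝓝[>] 0) := by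
    refine tendsto_nhdsWithin_iff.2 ⟨?_, ?_⟩
    · have : Continuous fun r : ℝ => r - s := by fun_prop
      simpa using (this.tendsto s).mono_left (nhdsWithin_le_nhds (s := Ioi s))
    · filter_upwards [self_mem_nhdsWithin] with r (hr : s < r) using sub_pos.2 hr
  have hsub : Tendsto (fun r : ℝ => h - r) (𝓝[>] s) (𝓝 (h - s)) :=
    ((continuous_const.sub continuous_id).tendsto s).mono_left nhdsWithin_le_nhds
  refine ((hT.continuous_ext_apply.tendsto _).comp
    (hsub.prodMk_nhds (hdiff.comp hshift))).congr' ?_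
  filter_upwards [self_mem_nhdsWithin, mem_nhdsWithin_of_mem_nhds (Iio_mem_nhds hsh)]
    with r hr hrh
  have hrs : 0 ≤ r - s := sub_nonneg.2 (le_of_lt hr)
  -- Since `T (h - s) = T (h - r) T (r - s)`, the increment is `T (h - r)` applied to the
  -- difference of two orbits starting at `z`.
  have e1 : S.ext r x = S.ext (r - s) z := by
    rw [hz, ← S.ext_add_apply hrs hs, sub_add_cancel]
  have e2 : T.ext (h - s) z = T.ext (h - r) (T.ext (r - s) z) := by
    rw [← T.ext_add_apply (sub_nonneg.2 (le_of_lt hrh)) hrs, sub_add_sub_cancel]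
  simp only [Function.comp_apply, slope_def_module, e1, ← hz, e2]
  rw [← map_sub, RCLike.real_smul_eq_coe_smul (K := 𝕜), RCLike.real_smul_eq_coe_smul (K := 𝕜),
    map_smul]

variable [CompleteSpace H]

/-- The generator is densely defined. -/
lemma IsLocallyBounded.dense_hasGen {T : C0Semigroup 𝕜 H} (hT : T.IsLocallyBounded) :
    Dense {x : H | ∃ y, T.HasGen x y} := by
  intro x
  have hc : Continuous fun s : ℝ => T.ext s x :=
    hT.continuous_ext_comp continuous_id continuous_const
  have hlim := (hasDerivAt_iff_tendsto_slope_zero.1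
      (hc.integral_hasStrictDerivAt 0 0).hasDerivAt).mono_left
        (nhdsWithin_mono 0 fun k (hk : k ∈ Ioi (0 : ℝ)) => ne_of_gt hk)
  rw [ext_zero_apply] at hlim
  simp only [zero_add, intervalIntegral.integral_same, sub_zero] at hlim
  refine mem_closure_of_tendsto hlim ?_
  filter_upwards [self_mem_nhdsWithin] with k hk
  exact ⟨_, (hT.hasGen_integral (le_of_lt hk) x).real_smul k⁻¹⟩

/-- Variation of constants, with the roles of the two semigroups fixed so that the perturbed
orbit appears under the integral. For `x` in the domain of the generator it is the fundamental
theorem of calculus for `s ↦ T(h - s) S(s) x`; both sides are continuous in `x`. -/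
lemma ext_eq_add_integral {T S : C0Semigroup 𝕜 H} (hT : T.IsLocallyBounded)
    (hS : S.IsLocallyBounded) {P : H →L[𝕜] H}
    (hTS : ∀ x y, S.HasGen x y → T.HasGen x (y - P x)) {h : ℝ} (hh : 0 ≤ h) (x : H) :
    S.ext h x = T.ext h x + ∫ s in (0 : ℝ)..h, T.ext (h - s) (P (S.ext s x)) := by
  have hSc : Continuous fun q : H × ℝ => S.ext q.2 q.1 :=
    hS.continuous_ext_comp continuous_snd continuous_fst
  have hc : Continuous fun q : H × ℝ => T.ext (h - q.2) (P (S.ext q.2 q.1)) :=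
    hT.continuous_ext_comp (by fun_prop) (P.continuous.comp hSc)
  have hclosed : IsClosed {x : H | S.ext h x =
      T.ext h x + ∫ s in (0 : ℝ)..h, T.ext (h - s) (P (S.ext s x))} :=
    isClosed_eq (S.ext h).continuous ((T.ext h).continuous.add
      (intervalIntegral.continuous_parametric_intervalIntegral_of_continuous' hc _ _))
  refine hclosed.closure_subset_iff.2 ?_ (hS.dense_hasGen x)
  rintro x ⟨y, hx⟩
  have hcx : Continuous fun s : ℝ => S.ext s x := hSc.comp (Continuous.prodMk_right x)
  have hftc := intervalIntegral.integral_eq_sub_of_hasDeriv_right (a := 0) (b := h)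
    (f := fun s => T.ext (h - s) (S.ext s x)) (f' := fun s => T.ext (h - s) (P (S.ext s x)))
    (hT.continuous_ext_comp (by fun_prop) hcx).continuousOn
    (fun s hs => by
      rw [min_eq_left hh, max_eq_right hh] at hs
      exact hasDerivWithinAt_ext_sub_ext hT hTS hx hs.1.le hs.2)
    ((hc.comp (Continuous.prodMk_right x)).intervalIntegrable _ _)
  change S.ext h x = T.ext h x + _
  rw [hftc]
  simp

end C0Semigroup

end Generator

/-! ### The Lyapunov function -/

section Lyapunov

variable {𝕜 : Type*} [RCLike 𝕜] {H : Type*} [NormedAddCommGroup H] [InnerProductSpace 𝕜 H]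
  {S : C0Semigroup 𝕜 H} {N ξ ζ : ℝ}

lemma exp_mul_norm_op_le (hS : ∀ t : ℝ, 0 ≤ t → ‖S.op t‖ ≤ N * Real.exp (-ξ * t))
    (hζ : ζ ≤ ξ) (x : H) {t : ℝ} (ht : 0 ≤ t) :
    Real.exp (ζ * t) * ‖S.op t x‖ ≤ N * ‖x‖ := by
  have hN : 0 ≤ N := by simpa using (norm_nonneg _).trans (hS 0 le_rfl)
  have h1 : Real.exp (ζ * t) * Real.exp (-ξ * t) ≤ 1 := by
    rw [← Real.exp_add, Real.exp_le_one_iff]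
    nlinarith
  calc Real.exp (ζ * t) * ‖S.op t x‖
      ≤ Real.exp (ζ * t) * (N * Real.exp (-ξ * t) * ‖x‖) := by
        gcongr
        exact (S.op t).le_of_opNorm_le (hS t ht) x
    _ = (Real.exp (ζ * t) * Real.exp (-ξ * t)) * (N * ‖x‖) := by ring
    _ ≤ 1 * (N * ‖x‖) := by gcongr
    _ = N * ‖x‖ := one_mul _

variable [NormedSpace ℝ H]

lemma lyapunovV_le {x : H} {c : ℝ}
    (h : ∀ t : ℝ, 0 ≤ t → Real.exp (ζ * t) * ‖S.op t x‖ ≤ c) : lyapunovV S ζ x ≤ c := by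
  refine csSup_le (nonempty_Ici.image _) ?_
  rintro _ ⟨t, ht, rfl⟩
  simpa [norm_smul] using h t ht

lemma bddAbove_weightedOrbitNorms
    (hS : ∀ t : ℝ, 0 ≤ t → ‖S.op t‖ ≤ N * Real.exp (-ξ * t)) (hζ : ζ ≤ ξ) (x : H) :
    BddAbove (weightedOrbitNorms S ζ x) := by
  refine ⟨N * ‖x‖, ?_⟩
  rintro _ ⟨t, ht, rfl⟩
  simpa [norm_smul] using exp_mul_norm_op_le hS hζ x ht

lemma lyapunovV_le_mul_norm (hS : ∀ t : ℝ, 0 ≤ t → ‖S.op t‖ ≤ N * Real.exp (-ξ * t))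
    (hζ : ζ ≤ ξ) (x : H) : lyapunovV S ζ x ≤ N * ‖x‖ :=
  lyapunovV_le fun _ ht => exp_mul_norm_op_le hS hζ x ht

lemma le_lyapunovV (hS : ∀ t : ℝ, 0 ≤ t → ‖S.op t‖ ≤ N * Real.exp (-ξ * t)) (hζ : ζ ≤ ξ)
    (x : H) {t : ℝ} (ht : 0 ≤ t) : Real.exp (ζ * t) * ‖S.op t x‖ ≤ lyapunovV S ζ x :=
  le_csSup (bddAbove_weightedOrbitNorms hS hζ x) ⟨t, ht, by simp [norm_smul]⟩

lemma norm_le_lyapunovV (hS : ∀ t : ℝ, 0 ≤ t → ‖S.op t‖ ≤ N * Real.exp (-ξ * t))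
    (hζ : ζ ≤ ξ) (x : H) : ‖x‖ ≤ lyapunovV S ζ x := by
  simpa [S.op_zero] using le_lyapunovV hS hζ x le_rfl

lemma lyapunovV_add_le (hS : ∀ t : ℝ, 0 ≤ t → ‖S.op t‖ ≤ N * Real.exp (-ξ * t))
    (hζ : ζ ≤ ξ) (x y : H) : lyapunovV S ζ (x + y) ≤ lyapunovV S ζ x + lyapunovV S ζ y := by
  refine lyapunovV_le fun t ht => ?_
  rw [map_add]
  calc _ ≤ Real.exp (ζ * t) * (‖S.op t x‖ + ‖S.op t y‖) := by gcongr; exact norm_add_le _ _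
    _ = Real.exp (ζ * t) * ‖S.op t x‖ + Real.exp (ζ * t) * ‖S.op t y‖ := mul_add _ _ _
    _ ≤ _ := add_le_add (le_lyapunovV hS hζ x ht) (le_lyapunovV hS hζ y ht)

lemma lyapunovV_smul_le [IsScalarTower ℝ 𝕜 H]
    (hS : ∀ t : ℝ, 0 ≤ t → ‖S.op t‖ ≤ N * Real.exp (-ξ * t))
    (hζ : ζ ≤ ξ) {c : ℝ} (hc : 0 ≤ c) (x : H) :
    lyapunovV S ζ (c • x) ≤ c * lyapunovV S ζ x := by
  refine lyapunovV_le fun t ht => ?_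
  rw [RCLike.real_smul_eq_coe_smul (K := 𝕜), map_smul, norm_smul, RCLike.norm_ofReal,
    abs_of_nonneg hc, mul_left_comm]
  exact mul_le_mul_of_nonneg_left (le_lyapunovV hS hζ x ht) hc

lemma lipschitzWith_lyapunovV (hS : ∀ t : ℝ, 0 ≤ t → ‖S.op t‖ ≤ N * Real.exp (-ξ * t))
    (hζ : ζ ≤ ξ) : LipschitzWith N.toNNReal (lyapunovV S ζ) := by
  refine LipschitzWith.of_le_add_mul' N fun x y => ?_
  have h1 := lyapunovV_add_le hS hζ y (x - y)
  have h2 := lyapunovV_le_mul_norm hS hζ (x - y)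
  rw [add_sub_cancel] at h1
  rw [dist_eq_norm]
  linarith

/-- The exponential weight makes `V` decay at rate `ζ` along the semigroup that defines it: a
shifted orbit is a tail of the original one. -/
lemma lyapunovV_ext_le (hS : ∀ t : ℝ, 0 ≤ t → ‖S.op t‖ ≤ N * Real.exp (-ξ * t))
    (hζ : ζ ≤ ξ) {h : ℝ} (hh : 0 ≤ h) (x : H) :
    lyapunovV S ζ (S.ext h x) ≤ Real.exp (-ζ * h) * lyapunovV S ζ x := by
  refine lyapunovV_le fun t ht => ?_
  have h1 := le_lyapunovV hS hζ x (add_nonneg ht hh)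
  rw [S.op_add t h ht hh, ContinuousLinearMap.comp_apply] at h1
  calc Real.exp (ζ * t) * ‖S.op t (S.ext h x)‖
      = Real.exp (-ζ * h) * (Real.exp (ζ * (t + h)) * ‖S.op t (S.op h x)‖) := by
        rw [S.ext_of_nonneg hh, ← mul_assoc, ← Real.exp_add]
        congr 2
        ring
    _ ≤ _ := by gcongr

/-- If a curve leaves `x` with velocity `r` relative to the orbit `S(h) x`, then the Dini
derivative of `V` along it is at most `-ζ V(x) + V(r)`. -/
lemma upperRightDini_lyapunovV_le [IsScalarTower ℝ 𝕜 H]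
    (hS : ∀ t : ℝ, 0 ≤ t → ‖S.op t‖ ≤ N * Real.exp (-ξ * t)) (hζ : ζ ≤ ξ)
    {y : ℝ → H} {x r : H} (hy0 : y 0 = x)
    (hy : Tendsto (fun h : ℝ => h⁻¹ • (y h - S.ext h x)) (𝓝[>] 0) (𝓝 r)) :
    upperRightDini (fun t => lyapunovV S ζ (y t)) 0 ≤
      ((-ζ * lyapunovV S ζ x + lyapunovV S ζ r : ℝ) : EReal) := by
  have hexp : Tendsto (fun h : ℝ => h⁻¹ * (Real.exp (-ζ * h) - 1)) (𝓝[>] 0) (𝓝 (-ζ)) := by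
    have hd : HasDerivAt (fun h : ℝ => Real.exp (-ζ * h)) (-ζ) 0 := by
      simpa using ((hasDerivAt_id (0 : ℝ)).const_mul (-ζ)).exp
    simpa using hd.tendsto_slope_zero_right
  have hlim := (hexp.mul_const (lyapunovV S ζ x)).add
    (((lipschitzWith_lyapunovV hS hζ).continuous.tendsto r).comp hy)
  rw [← ((continuous_coe_real_ereal.tendsto _).comp hlim).limsup_eq, upperRightDini]
  refine limsup_le_limsup ?_
  filter_upwards [self_mem_nhdsWithin] with h hh
  have hh' : 0 < h := hh
  simp only [Function.comp_apply, zero_add, hy0, EReal.coe_le_coe_iff]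
  set q := h⁻¹ • (y h - S.ext h x) with hq
  have hyq : y h = S.ext h x + h • q := by
    rw [hq, smul_inv_smul₀ hh'.ne', add_sub_cancel]
  have h1 : lyapunovV S ζ (y h) ≤
      Real.exp (-ζ * h) * lyapunovV S ζ x + h * lyapunovV S ζ q := by
    rw [hyq]
    exact (lyapunovV_add_le hS hζ _ _).trans (add_le_add (lyapunovV_ext_le hS hζ hh'.le x)
      (lyapunovV_smul_le hS hζ hh'.le q))
  rw [div_le_iff₀ hh']
  calc _ ≤ Real.exp (-ζ * h) * lyapunovV S ζ x + h * lyapunovV S ζ q - lyapunovV S ζ x := by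
        linarith
    _ = _ := by field_simp; ring

end Lyapunov

/-! ### Mild solutions -/

section Mild

variable {𝕜 : Type*} [RCLike 𝕜] {H : Type*} [NormedAddCommGroup H] [InnerProductSpace 𝕜 H]
  {T : C0Semigroup 𝕜 H} {g : H → H} {d : ℝ → H} {x : H} {y : ℝ → H}

lemma ContinuousOn.continuous_comp_max_zero (hd : ContinuousOn d (Ici 0)) :
    Continuous fun s : ℝ => d (max s 0) :=
  hd.comp_continuous (by fun_prop) fun s => le_max_right s 0

lemma continuous_volterraKernel (hT : T.IsLocallyBounded) (hg : Continuous g)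
    (hd : ContinuousOn d (Ici 0)) :
    Continuous fun q : ℝ × ℝ × H => T.ext (q.1 - q.2.1) (g q.2.2 + d (max q.2.1 0)) :=
  hT.continuous_ext_comp (by fun_prop) ((hg.comp (by fun_prop)).add
    (hd.continuous_comp_max_zero.comp (by fun_prop)))

lemma volterraKernel_lipschitz (hT : T.IsLocallyBounded) {L : NNReal} (hg : LipschitzWith L g)
    (τ : ℝ) : ∃ C : ℝ, ∀ t s, 0 ≤ s → s ≤ t → t ≤ τ → ∀ v w : H,
      ‖T.ext (t - s) (g v + d (max s 0)) - T.ext (t - s) (g w + d (max s 0))‖ ≤ C * ‖v - w‖ := by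
  obtain ⟨C, hC⟩ := hT τ
  refine ⟨C * L, fun t s hs _ ht v w => ?_⟩
  have hCt := hC (t - s) (by linarith)
  rw [← map_sub, add_sub_add_right_eq_sub, mul_assoc]
  exact ((T.ext (t - s)).le_of_opNorm_le hCt _).trans
    (mul_le_mul_of_nonneg_left (hg.norm_sub_le v w) ((norm_nonneg _).trans hCt))

variable [NormedSpace ℝ H]

/-- The right-hand integrand extends to a function of `(t, s)` on the whole plane, continuous when
`w` is continuous on `[0, ∞)`. -/
lemma integral_op_eq_integral_ext (w : ℝ → H) {t : ℝ} (ht : 0 ≤ t) :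
    ∫ s in (0 : ℝ)..t, T.op (t - s) (w s) = ∫ s in (0 : ℝ)..t, T.ext (t - s) (w (max s 0)) := by
  refine intervalIntegral.integral_congr fun s hs => ?_
  rw [uIcc_of_le ht] at hs
  simp only [max_eq_left hs.1, T.ext_of_nonneg (sub_nonneg.2 hs.2)]

lemma isMildSolution_iff_volterra :
    IsMildSolution T g d x y ↔ ContinuousOn y (Ici 0) ∧ ∀ t : ℝ, 0 ≤ t →
      y t = T.ext t x + ∫ s in (0 : ℝ)..t, T.ext (t - s) (g (y s) + d (max s 0)) := by
  refine and_congr_right fun _ => forall₂_congr fun t ht => ?_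
  rw [integral_op_eq_integral_ext _ ht, T.ext_of_nonneg ht]
  have : ∫ s in (0 : ℝ)..t, T.ext (t - s) (g (y (max s 0)) + d (max s 0)) =
      ∫ s in (0 : ℝ)..t, T.ext (t - s) (g (y s) + d (max s 0)) := by
    refine intervalIntegral.integral_congr fun s hs => ?_
    rw [uIcc_of_le ht] at hs
    simp only [max_eq_left hs.1]
  rw [this]

lemma IsMildSolution.congr {z : ℝ → H} (hy : IsMildSolution T g d x y) (h : EqOn z y (Ici 0)) :
    IsMildSolution T g d x z := by
  refine ⟨hy.1.congr h, fun t ht => ?_⟩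
  rw [h ht, hy.2 t ht]
  congr 1
  refine intervalIntegral.integral_congr fun s hs => ?_
  rw [uIcc_of_le ht] at hs
  simp only [h hs.1]

lemma IsMildSolution.apply_zero (hy : IsMildSolution T g d x y) : y 0 = x := by
  simpa [T.op_zero] using hy.2 0 le_rfl

lemma IsMildSolution.eqOn (hT : T.IsLocallyBounded) {L : NNReal} (hg : LipschitzWith L g)
    (hd : ContinuousOn d (Ici 0)) {z : ℝ → H} (hy : IsMildSolution T g d x y)
    (hz : IsMildSolution T g d x z) : EqOn y z (Ici 0) := by
  rw [isMildSolution_iff_volterra] at hy hz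
  intro t ht
  exact IsVolterraSolutionOn.eqOn (τ := t) (continuous_volterraKernel hT hg.continuous hd)
    (hT.continuous_ext_comp continuous_id (continuous_const (y := x)))
    (volterraKernel_lipschitz hT hg t)
    ⟨hy.1.mono Icc_subset_Ici_self, fun s hs => hy.2 s hs.1⟩
    ⟨hz.1.mono Icc_subset_Ici_self, fun s hs => hz.2 s hs.1⟩ ⟨ht, le_rfl⟩

variable [CompleteSpace H]

lemma exists_isMildSolution (hT : T.IsLocallyBounded) {L : NNReal} (hg : LipschitzWith L g)
    (hd : ContinuousOn d (Ici 0)) : ∃ y, IsMildSolution T g d x y := by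
  obtain ⟨y, hy⟩ := exists_global_volterraSolution
    (continuous_volterraKernel hT hg.continuous hd)
    (hT.continuous_ext_comp continuous_id (continuous_const (y := x)))
    (volterraKernel_lipschitz hT hg)
  exact ⟨y, isMildSolution_iff_volterra.2 hy⟩

/-- At time `0` a mild solution leaves the orbit `S(h) x` of the perturbed semigroup with velocity
`g(x) + d(0) - P x`. The unbounded generator does not appear, so `x` need not lie in its
domain. -/
lemma IsMildSolution.tendsto_inv_smul_sub [IsScalarTower ℝ 𝕜 H] {S : C0Semigroup 𝕜 H}
    (hT : T.IsLocallyBounded) (hS : S.IsLocallyBounded) {P : H →L[𝕜] H}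
    (hTS : ∀ x y, S.HasGen x y → T.HasGen x (y - P x)) (hg : Continuous g)
    (hd : ContinuousOn d (Ici 0)) (hy : IsMildSolution T g d x y) :
    Tendsto (fun h : ℝ => h⁻¹ • (y h - S.ext h x)) (𝓝[>] 0) (𝓝 (g x + d 0 - P x)) := by
  have hw : Continuous fun s : ℝ => g (y (max s 0)) + d (max s 0) :=
    (hg.comp hy.1.continuous_comp_max_zero).add hd.continuous_comp_max_zero
  have hp : Continuous fun s : ℝ => P (S.ext s x) :=
    P.continuous.comp (hS.continuous_ext_comp continuous_id continuous_const)
  have hlim := hT.tendsto_inv_smul_convolution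
    (w := fun s => g (y (max s 0)) + d (max s 0) - P (S.ext s x)) (hw.sub hp)
  simp only [max_self, hy.apply_zero, C0Semigroup.ext_zero_apply] at hlim
  refine hlim.congr' ?_
  filter_upwards [self_mem_nhdsWithin] with h hh
  have hh' : 0 ≤ h := le_of_lt hh
  have hint : ∀ w : ℝ → H, Continuous w →
      IntervalIntegrable (fun s => T.ext (h - s) (w s)) MeasureTheory.volume 0 h := fun w hw =>
    (hT.continuous_ext_comp (by fun_prop) hw).intervalIntegrable _ _
  rw [hy.2 h hh', C0Semigroup.ext_eq_add_integral hT hS hTS hh' x,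
    integral_op_eq_integral_ext _ hh', T.ext_of_nonneg hh', add_sub_add_left_eq_sub,
    ← intervalIntegral.integral_sub (hint _ hw) (hint _ hp)]
  simp only [map_sub]

end Mild

lemma IsKInfty.mul_left {c : ℝ} (hc : 0 < c) : IsKInfty fun r => c * r :=
  ⟨mul_zero c, (continuous_const.mul continuous_id).continuousOn,
    (strictMono_mul_left_of_pos hc).strictMonoOn _, tendsto_id.const_mul_atTop hc⟩

/-! ### The dissipation inequality -/

theorem mainTheorem2 {𝕜 : Type*} [RCLike 𝕜]
    {H : Type*} [NormedAddCommGroup H] [InnerProductSpace 𝕜 H] [CompleteSpace H]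
    [NormedSpace ℝ H] [IsScalarTower ℝ 𝕜 H]
    {U : Type*} [NormedAddCommGroup U] [InnerProductSpace 𝕜 U] [CompleteSpace U]
    (A : H →ₗ.[𝕜] H) (T : C0Semigroup 𝕜 H) (hA : T.IsGenerator A)
    (M ν : ℝ) (hM : 1 ≤ M) (hν : 0 < ν)
    (hT : ∀ t : ℝ, 0 ≤ t → ‖T.op t‖ ≤ M * Real.exp (ν * t))
    (B : U →L[𝕜] H) (F : H →L[𝕜] U) (hF : IsCompactOperator F)
    (TBF : C0Semigroup 𝕜 H)
    (hTBFgen : TBF.IsGenerator ((B.comp F : H →L[𝕜] H).toLinearMap +ᵥ A))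
    (N ξ : ℝ) (hN : 1 ≤ N) (hξ : 0 < ξ)
    (hTBF : ∀ t : ℝ, 0 ≤ t → ‖TBF.op t‖ ≤ N * Real.exp (-ξ * t))
    (f : U → U) (hfLip : ∃ L : NNReal, LipschitzWith L (fun x : H => f (F x)))
    (θ : ℝ) (hθ : 0 < θ) (hsector : ∀ x : H, ‖f (F x) - F x‖ ≤ θ * ‖x‖)
    (β : ℝ) (hβ : β = M * N * ‖B‖)
    (hθβ : θ * β < ξ * M)
    (ζ : ℝ) (hζ : ζ ∈ Set.Ioo (θ * β * M⁻¹) ξ) :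
    ∃ φ : ℝ → H → (ℝ → H) → H,
      IsMildFlow T (fun x => B (f (F x))) φ ∧
      (∀ x : H, BddAbove (weightedOrbitNorms TBF ζ x)) ∧
      IsCoerciveISSLyapunov φ (lyapunovV TBF ζ) ∧
      (∃ K : NNReal, LipschitzWith K (lyapunovV TBF ζ)) ∧
      ∀ (x : H) (d : ℝ → H), IsDisturbance d →
        flowDeriv φ (lyapunovV TBF ζ) d x ≤
          ((-(ζ - θ * β * M⁻¹) * lyapunovV TBF ζ x + N * ‖d 0‖ : ℝ) : EReal) := by
  obtain ⟨L, hL⟩ := hfLip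
  obtain ⟨hζ1, hζ2⟩ := hζ
  have hM0 : 0 < M := by linarith
  have hN0 : 0 < N := by linarith
  have hβM : θ * β * M⁻¹ = θ * (N * ‖B‖) := by
    rw [hβ]
    field_simp
  have hTb : T.IsLocallyBounded := C0Semigroup.isLocallyBounded_of_le_exp hT
  have hSb : TBF.IsLocallyBounded := C0Semigroup.isLocallyBounded_of_le_exp hTBF
  have hg : LipschitzWith (‖B‖₊ * L) fun x => B (f (F x)) := B.lipschitz.comp hL
  -- The generators of the two semigroups differ by `B ∘ F` on their common domain.
  have hTS : ∀ x y, TBF.HasGen x y → T.HasGen x (y - (B.comp F) x) := by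
    intro x y hxy
    rw [← hTBFgen.mem_graph_iff, LinearPMap.mem_graph_iff] at hxy
    obtain ⟨z, hzx, hzy⟩ := hxy
    rw [← hA.mem_graph_iff, LinearPMap.mem_graph_iff]
    refine ⟨z, hzx, ?_⟩
    change (z : H) = x at hzx
    change (B.comp F) (z : H) + A z = y at hzy
    change A z = y - (B.comp F) x
    rw [← hzy, ← hzx, add_sub_cancel_left]
  have hdc : ∀ d : ℝ → H, IsDisturbance d → ContinuousOn d (Ici 0) := fun d hd => hd.continuousOn
  have hex : ∀ (x : H) (d : ℝ → H), ∃ y, IsDisturbance d →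
      IsMildSolution T (fun x => B (f (F x))) d x y := by
    intro x d
    by_cases hd : IsDisturbance d
    · obtain ⟨y, hy⟩ := exists_isMildSolution (x := x) hTb hg (hdc d hd)
      exact ⟨y, fun _ => hy⟩
    · exact ⟨0, fun h => absurd h hd⟩
  choose Y hY using hex
  have hdini : ∀ (x : H) (d : ℝ → H), IsDisturbance d →
      flowDeriv (fun t x d => Y x d t) (lyapunovV TBF ζ) d x ≤
        ((-(ζ - θ * β * M⁻¹) * lyapunovV TBF ζ x + N * ‖d 0‖ : ℝ) : EReal) := by
    intro x d hd
    have hy := hY x d hd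
    refine (upperRightDini_lyapunovV_le hTBF hζ2.le hy.apply_zero
      (hy.tendsto_inv_smul_sub hTb hSb hTS hg.continuous (hdc d hd))).trans ?_
    rw [EReal.coe_le_coe_iff, hβM]
    -- The linear part `B (F x)` of the nonlinearity is absorbed by the perturbed semigroup, and
    -- the sector bound controls what is left, with `‖x‖ ≤ V x`.
    have hr : ‖B (f (F x)) + d 0 - (B.comp F) x‖ ≤
        ‖B‖ * (θ * lyapunovV TBF ζ x) + ‖d 0‖ := by
      have e : B (f (F x)) + d 0 - (B.comp F) x = B (f (F x) - F x) + d 0 := by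
        rw [map_sub, ContinuousLinearMap.comp_apply]
        abel
      rw [e]
      refine (norm_add_le _ _).trans (add_le_add_left ((B.le_opNorm _).trans ?_) _)
      have := norm_le_lyapunovV hTBF hζ2.le x
      have := hsector x
      gcongr
      exact this.trans (by gcongr)
    have hV := (lyapunovV_le_mul_norm hTBF hζ2.le _).trans (mul_le_mul_of_nonneg_left hr hN0.le)
    linarith
  refine ⟨fun t x d => Y x d t, fun x d hd y => ⟨fun hy => hy.eqOn hTb hg (hdc d hd) (hY x d hd),
    fun h => (hY x d hd).congr h⟩, bddAbove_weightedOrbitNorms hTBF hζ2.le, ?_,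
    ⟨_, lipschitzWith_lyapunovV hTBF hζ2.le⟩, hdini⟩
  refine ⟨(lipschitzWith_lyapunovV hTBF hζ2.le).continuous,
    fun x => (norm_nonneg x).trans (norm_le_lyapunovV hTBF hζ2.le x),
    ⟨_, _, IsKInfty.mul_left one_pos, IsKInfty.mul_left hN0, fun x => ⟨?_, ?_⟩⟩,
    ⟨_, _, IsKInfty.mul_left (sub_pos.2 hζ1), IsKInfty.mul_left hN0, fun x d hd => ?_⟩⟩
  · simpa using norm_le_lyapunovV hTBF hζ2.le x
  · exact lyapunovV_le_mul_norm hTBF hζ2.le x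
  · simpa only [neg_mul] using hdini x d hd
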